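/- Let $\Lambda$ be a quantum channel (a completely positive, trace-preserving linear map) on the complex $d\times d$ matrices, and let $\Pi\neq 0$ be an orthogonal projector on $\mathbb{C}^d$ (onto the undesired subspace). Put $\epsilon(\Lambda)=\operatorname{tr}[\Pi\,\Lambda(\mathbb{1})]$. For a channel $\Gamma$ let $M^{\Gamma}=\sum_{m,n}|m\rangle\langle n|\otimes\Gamma(|m\rangle\langle n|)$ be its Choi matrix, for a bipartite operator $X$ let $\phi_X=d^{-1}\operatorname{tr}_1X$, and let $g_M(X,Y)=\operatorname{tr}(\phi_M^{-1}\phi_X\phi_M^{-1}\phi_Y)$. Define the geometric complexity $$\mathcal{C}(\Lambda)=\inf_{\{\Lambda_t\}}\int_0^1\sqrt{g_{M_t}(\dot M_t,\dot M_t)}\,dt\in[0,\infty],\qquad M_t=M^{\Lambda_t},$$ where the infimum runs over all paths of quantum channels $\{\Lambda_t\}_{0\le t\le 1}$ with $\Lambda_0=\mathsf{Id}$ and $\Lambda_1=\Lambda$ such that $t\mapsto M_t$ is continuous on $[0,1]$ and differentiable outside a countable set of times; the integrand is $+\infty$ where $\phi_{M_t}$ is singular. Then $$e^{\mathcal{C}(\Lambda)}\cdot\epsilon(\Lambda)\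 \ge\ 1 .$$ Precisely: if $\mathcal{C}(\Lambda)<\infty$, this inequality holds between real numbers; and if $\epsilon(\Lambda)=0$, then $\mathcal{C}(\Lambda)=\infty$. -/

import Mathlib

noncomputable section

open scoped ENNReal

section Channels

open scoped Matrix.Norms.L2Operator MatrixOrder

/-- A quantum channel on a `d`-dimensional system: a completely positive, trace-preserving linear
map on the complex `d × d` matrices (a C⋆-algebra with the operator norm and the Loewner order). -/
structure QuantumChannel (d : ℕ) extends
    CompletelyPositiveMap (Matrix (Fin d) (Fin d) ℂ) (Matrix (Fin d) (Fin d) ℂ) where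
  trace_map : ∀ X : Matrix (Fin d) (Fin d) ℂ, (toLinearMap X).trace = X.trace

/-- The identity channel. -/
def QuantumChannel.identity (d : ℕ) : QuantumChannel d where
  toLinearMap := LinearMap.id
  map_cstarMatrix_nonneg' := fun _ _ hM => hM
  trace_map := fun _ => rfl

/-- The underlying linear map of a quantum channel. -/
def QuantumChannel.map {d : ℕ} (Λ : QuantumChannel d) :
    Matrix (Fin d) (Fin d) ℂ →ₗ[ℂ] Matrix (Fin d) (Fin d) ℂ :=
  Λ.toLinearMap

end Channels

open scoped Kronecker in
/-- The (unnormalised) Choi matrix `(𝟙 ⊗ Λ)(|Ω⟩⟨Ω|) = ∑ m n, |m⟩⟨n| ⊗ Λ(|m⟩⟨n|)`,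
where `|Ω⟩ = ∑ n, |n⟩ ⊗ |n⟩`. -/
def choiMatrix {d : ℕ} (Λ : QuantumChannel d) : Matrix (Fin d × Fin d) (Fin d × Fin d) ℂ :=
  ∑ m : Fin d, ∑ n : Fin d, Matrix.single m n (1 : ℂ) ⊗ₖ Λ.map (Matrix.single m n 1)

/-- The partial trace over the first tensor factor. -/
def partialTraceFst {d : ℕ} (X : Matrix (Fin d × Fin d) (Fin d × Fin d) ℂ) :
    Matrix (Fin d) (Fin d) ℂ :=
  Matrix.of fun i j => ∑ k : Fin d, X (k, i) (k, j)

/-- `φ_X = d⁻¹ tr₁ X`. -/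
def reducedOperator {d : ℕ} (X : Matrix (Fin d × Fin d) (Fin d × Fin d) ℂ) :
    Matrix (Fin d) (Fin d) ℂ :=
  (d : ℂ)⁻¹ • partialTraceFst X

/-- `g_M(X, Y) = tr (φ_M⁻¹ φ_X φ_M⁻¹ φ_Y)`; meaningful where `φ_M` is invertible. -/
def choiMetric {d : ℕ} (M X Y : Matrix (Fin d × Fin d) (Fin d × Fin d) ℂ) : ℂ :=
  ((reducedOperator M)⁻¹ * reducedOperator X * (reducedOperator M)⁻¹ * reducedOperator Y).trace

open Classical in
/-- The line element `√(g_M(X, X))`. It is `∞` where `φ_M` is singular. (For `M` the Choi matrix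
of a channel with `φ_M` invertible and `X` Hermitian, `g_M(X, X)` is a nonnegative real.) -/
def lineElement {d : ℕ} (M X : Matrix (Fin d × Fin d) (Fin d × Fin d) ℂ) : ℝ≥0∞ :=
  if IsUnit (reducedOperator M) then ENNReal.ofReal (Real.sqrt (choiMetric M X X).re) else ∞

/-- `Γ` restricted to `[0, 1]` is a path of channels from the identity channel to `Λ`: its Choi
matrix is continuous on `[0, 1]` and differentiable off a countable set of times.
Values of `Γ` outside `[0, 1]` are irrelevant. -/
structure IsChannelPath {d : ℕ} (Λ : QuantumChannel d) (Γ : ℝ → QuantumChannel d) : Prop where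
  source : Γ 0 = QuantumChannel.identity d
  target : Γ 1 = Λ
  continuousOn : ContinuousOn (fun t => choiMatrix (Γ t)) (Set.Icc 0 1)
  differentiable : ∃ s : Set ℝ, s.Countable ∧
    ∀ t ∈ Set.Ioo (0 : ℝ) 1 \ s, DifferentiableAt ℝ (fun t => choiMatrix (Γ t)) t

/-- The length `∫₀¹ √(g_{M_t}(Ṁ_t, Ṁ_t)) dt` of a path of channels with Choi matrices `M_t`. -/
def pathLength {d : ℕ} (Γ : ℝ → QuantumChannel d) : ℝ≥0∞ :=
  ∫⁻ t in Set.Ioo (0 : ℝ) 1,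
    lineElement (choiMatrix (Γ t)) (deriv (fun t => choiMatrix (Γ t)) t)

/-- The geometric complexity of `Λ`: the geodesic length from the identity channel to `Λ`. -/
def geometricComplexity {d : ℕ} (Λ : QuantumChannel d) : ℝ≥0∞ :=
  ⨅ (Γ : ℝ → QuantumChannel d) (_ : IsChannelPath Λ Γ), pathLength Γ

/-- The error `tr [P Λ(𝟙)]` (a real number when `P` is an orthogonal projection). -/
def resetError {d : ℕ} (P : Matrix (Fin d) (Fin d) ℂ) (Λ : QuantumChannel d) : ℝ :=
  (P * Λ.map 1).trace.re

end

/-!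
Along a path of channels `Γ` with Choi matrices `M_t`, the operator `ρ_t = φ_{M_t} = d⁻¹ Γ_t(𝟙)` is
positive semidefinite, and `tr [P ρ_t]` is, up to the factor `d`, the error of `Γ_t`. The point is
that the metric controls the logarithmic derivative of the error: where `ρ = ρ_t` is invertible,
write `ρ = Bᴴ B`; for Hermitian `X`,
`tr (P X) = tr ((B P Bᴴ) (B⁻ᴴ X B⁻¹))`, and Cauchy–Schwarz for the Hilbert–Schmidt inner product
together with `‖A‖₂ ≤ tr A` for the positive semidefinite matrix `A = B P Bᴴ` gives
`|tr (P X)| ≤ tr (P ρ) √(tr (ρ⁻¹ X ρ⁻¹ X))` (`abs_re_trace_mul_le`). With `X = φ_{Ṁ_t}` the square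
root is the line element.

Integrating (`le_exp_lintegral_mul_of_abs_deriv_le`) yields `ε(Id) ≤ exp (length) * ε(Λ)` for every
path of finite length, and `ε(Id) = tr P ≥ 1` since `P` is a nonzero projection. The infimum over
paths gives the claim. The error is not known in advance to stay positive along the path,
so the logarithm is taken of the error shifted by `δ > 0`, and then `δ` tends to `0`.
-/

open scoped ENNReal
open MeasureTheory Set Filter Topology

/-! ### A Grönwall inequality with an extended-real rate -/

/-- If `f ≥ 0` and `|f'| ≤ f g` off a countable set of times, then `f` decays at most by the factor
`exp (-∫ g)` on `[0, 1]`. The rate `g` need not be measurable, and `f` may vanish a priori; no bound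
is required where `g = ∞`. -/
theorem le_exp_lintegral_mul_of_abs_deriv_le {f : ℝ → ℝ} {g : ℝ → ℝ≥0∞} {s : Set ℝ}
    (hs : s.Countable) (hc : ContinuousOn f (Icc 0 1))
    (hd : ∀ t ∈ Ioo (0 : ℝ) 1 \ s, DifferentiableAt ℝ f t)
    (hf : ∀ t ∈ Icc (0 : ℝ) 1, 0 ≤ f t)
    (hb : ∀ t ∈ Ioo (0 : ℝ) 1 \ s, g t ≠ ∞ → |deriv f t| ≤ f t * (g t).toReal)
    (hg : ∫⁻ t in Ioo (0 : ℝ) 1, g t ≠ ∞) :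
    f 0 ≤ Real.exp (∫⁻ t in Ioo (0 : ℝ) 1, g t).toReal * f 1 := by
  set L := (∫⁻ t in Ioo (0 : ℝ) 1, g t).toReal with hL
  have key : ∀ δ : ℝ, 0 < δ → f 0 + δ ≤ Real.exp L * (f 1 + δ) := by
    intro δ hδ
    -- The shift by `δ` keeps the logarithm differentiable even where `f` might vanish.
    have hpos : ∀ t ∈ Icc (0 : ℝ) 1, 0 < f t + δ := fun t ht => by linarith [hf t ht]
    set h' : ℝ → ℝ := fun t => deriv f t / (f t + δ) with hh'
    have hcd : ContinuousOn (fun t => f t + δ) (Icc 0 1) := hc.add continuousOn_const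
    have hlog : ContinuousOn (fun t => Real.log (f t + δ)) (Icc 0 1) :=
      hcd.log fun t ht => (hpos t ht).ne'
    have hder : ∀ t ∈ Ioo (0 : ℝ) 1 \ s,
        HasDerivAt (fun t => Real.log (f t + δ)) (h' t) t := fun t ht =>
      ((hd t ht).hasDerivAt.add_const δ).log (hpos t (Ioo_subset_Icc_self ht.1)).ne'
    have hbd : ∀ᵐ t ∂volume.restrict (Ioo (0 : ℝ) 1), ‖h' t‖ₑ ≤ g t := by
      filter_upwards [ae_restrict_mem measurableSet_Ioo,
        ae_restrict_of_ae (hs.ae_notMem volume)] with t ht hts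
      by_cases hgt : g t = ∞
      · simp [hgt]
      have hp := hpos t (Ioo_subset_Icc_self ht)
      rw [← ofReal_norm]
      refine ENNReal.ofReal_le_of_le_toReal ?_
      rw [hh', norm_div, Real.norm_eq_abs, Real.norm_of_nonneg hp.le, div_le_iff₀ hp]
      have := hb t ⟨ht, hts⟩ hgt
      nlinarith [ENNReal.toReal_nonneg (a := g t)]
    have hle : ∫⁻ t in Ioo (0 : ℝ) 1, ‖h' t‖ₑ ≤ ∫⁻ t in Ioo (0 : ℝ) 1, g t :=
      lintegral_mono_ae hbd
    -- Only `h'` has to be measurable: the comparison with `g` holds for lower integrals.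
    have hmeas : AEStronglyMeasurable h' (volume.restrict (Ioo (0 : ℝ) 1)) :=
      ((measurable_deriv f).aemeasurable.div
        ((hcd.mono Ioo_subset_Icc_self).aemeasurable measurableSet_Ioo)).aestronglyMeasurable
    have hint : Integrable h' (volume.restrict (Ioo (0 : ℝ) 1)) :=
      ⟨hmeas, lt_of_le_of_lt hle hg.lt_top⟩
    have hII : IntervalIntegrable h' volume 0 1 := by
      rw [intervalIntegrable_iff_integrableOn_Ioo_of_le zero_le_one]
      exact hint
    have hftc := integral_eq_of_hasDerivAt_off_countable_of_le _ h' zero_le_one hs hlog hder hII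
    have habs : ‖∫ t in (0 : ℝ)..1, h' t‖ ≤ L := by
      rw [intervalIntegral.integral_of_le zero_le_one, integral_Ioc_eq_integral_Ioo]
      refine (norm_integral_le_lintegral_norm _).trans ?_
      refine ENNReal.toReal_mono hg ?_
      simpa only [ofReal_norm] using hle
    rw [hftc, Real.norm_eq_abs] at habs
    have h0 := hpos 0 (by simp)
    have h1 := hpos 1 (by simp)
    have : Real.log (f 0 + δ) ≤ L + Real.log (f 1 + δ) := by
      linarith [(abs_le.1 habs).1]
    rw [← Real.exp_le_exp, Real.exp_add, Real.exp_log h0, Real.exp_log h1] at this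
    exact this
  have lim1 : Tendsto (fun δ : ℝ => f 0 + δ) (𝓝[>] 0) (𝓝 (f 0)) := by
    have : Continuous fun δ : ℝ => f 0 + δ := by fun_prop
    simpa using (this.tendsto 0).mono_left nhdsWithin_le_nhds
  have lim2 : Tendsto (fun δ : ℝ => Real.exp L * (f 1 + δ)) (𝓝[>] 0) (𝓝 (Real.exp L * f 1)) := by
    have : Continuous fun δ : ℝ => Real.exp L * (f 1 + δ) := by fun_prop
    simpa using (this.tendsto 0).mono_left nhdsWithin_le_nhds
  exact le_of_tendsto_of_tendsto lim1 lim2 (eventually_mem_nhdsWithin.mono fun δ hδ => key δ hδ)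

/-! ### The Hilbert–Schmidt inner product and projections -/

section Frobenius
open Matrix
open scoped Matrix.Norms.Frobenius ComplexOrder MatrixOrder

variable {n : Type*} [Fintype n]

theorem frobenius_norm_sq_eq_trace (A : Matrix n n ℂ) : ‖A‖ ^ 2 = (Aᴴ * A).trace.re := by
  rw [frobenius_norm_def, ← Real.sqrt_eq_rpow, Real.sq_sqrt (by positivity)]
  simp only [trace, diag, mul_apply, conjTranspose_apply, Complex.re_sum]
  rw [Finset.sum_comm]
  refine Finset.sum_congr rfl fun i _ => Finset.sum_congr rfl fun j _ => ?_
  rw [Complex.star_def, ← Complex.normSq_eq_conj_mul_self, Complex.ofReal_re,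
    Complex.normSq_eq_norm_sq]
  simp

/-- The Cauchy–Schwarz inequality for the Hilbert–Schmidt inner product. -/
theorem norm_trace_mul_le (A B : Matrix n n ℂ) : ‖(A * B).trace‖ ≤ ‖A‖ * ‖B‖ := by
  rw [frobenius_norm_def, frobenius_norm_def, ← Real.sqrt_eq_rpow, ← Real.sqrt_eq_rpow]
  simp only [trace, diag, mul_apply]
  calc ‖∑ i, ∑ j, A i j * B j i‖ ≤ ∑ i, ∑ j, ‖A i j‖ * ‖B j i‖ :=
        (norm_sum_le _ _).trans (Finset.sum_le_sum fun i _ => (norm_sum_le _ _).trans_eq (by simp))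
    _ = ∑ p : n × n, ‖A p.1 p.2‖ * ‖B p.2 p.1‖ := by rw [Fintype.sum_prod_type]
    _ ≤ √(∑ p : n × n, ‖A p.1 p.2‖ ^ 2) * √(∑ p : n × n, ‖B p.2 p.1‖ ^ 2) :=
        Real.sum_mul_le_sqrt_mul_sqrt _ _ _
    _ = _ := by
        rw [Fintype.sum_prod_type, Fintype.sum_prod_type_right]
        simp

/-- The Hilbert–Schmidt norm of a positive semidefinite matrix is at most its trace. -/
theorem norm_conjTranspose_mul_self_le_trace (B : Matrix n n ℂ) :
    ‖Bᴴ * B‖ ≤ (Bᴴ * B).trace.re := by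
  rw [← frobenius_norm_sq_eq_trace, sq]
  exact (frobenius_norm_mul _ _).trans_eq (by rw [frobenius_norm_conjTranspose])

/-- The logarithmic derivative of `ρ ↦ tr (P ρ)` in a Hermitian direction `X` is bounded by the
length of `X` in the metric `tr (ρ⁻¹ X ρ⁻¹ X)`. -/
theorem abs_re_trace_mul_le [DecidableEq n] {P ρ X : Matrix n n ℂ} (hP : IsStarProjection P)
    (hρ : ρ.PosSemidef) (hu : IsUnit ρ) (hX : X.IsHermitian) :
    |(P * X).trace.re| ≤ (P * ρ).trace.re * √(ρ⁻¹ * X * ρ⁻¹ * X).trace.re := by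
  have hPP : P * P = P := hP.isIdempotentElem
  have hPh : Pᴴ = P := hP.isSelfAdjoint
  obtain ⟨B, rfl⟩ : ∃ B : Matrix n n ℂ, ρ = Bᴴ * B :=
    (CStarAlgebra.nonneg_iff_eq_star_mul_self (a := ρ)).1 hρ.nonneg
  have hB : IsUnit B.det := by
    rw [isUnit_iff_isUnit_det, det_mul] at hu
    exact isUnit_of_mul_isUnit_right hu
  have hBh : IsUnit Bᴴ.det := by
    rw [det_conjTranspose]; exact hB.star
  have hX' : Xᴴ = X := hX
  set Y := (Bᴴ)⁻¹ * X * B⁻¹ with hY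
  set C := P * Bᴴ with hC
  have hCC : Cᴴ * C = B * P * Bᴴ := by
    rw [hC, conjTranspose_mul, conjTranspose_conjTranspose, hPh, ← mul_assoc, mul_assoc B, hPP]
  have hYh : Yᴴ = Y := by
    rw [hY]
    simp [conjTranspose_nonsing_inv, hX', mul_assoc]
  have e1 : (Cᴴ * C * Y).trace = (P * X).trace := by
    have : Cᴴ * C * Y = B * (P * X * B⁻¹) := by
      rw [hCC, hY]
      simp only [mul_assoc]
      rw [mul_nonsing_inv_cancel_left _ _ hBh]
    rw [this, trace_mul_comm, nonsing_inv_mul_cancel_right _ _ hB]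
  have e2 : (Cᴴ * C).trace = (P * (Bᴴ * B)).trace := by
    rw [hCC, mul_assoc, trace_mul_comm, mul_assoc]
  have e3 : (Yᴴ * Y).trace = ((Bᴴ * B)⁻¹ * X * (Bᴴ * B)⁻¹ * X).trace := by
    rw [hYh, hY, Matrix.mul_inv_rev, ← mul_assoc, trace_mul_comm]
    simp only [mul_assoc]
  calc |(P * X).trace.re| ≤ ‖(Cᴴ * C * Y).trace‖ := by rw [e1]; exact Complex.abs_re_le_norm _
    _ ≤ ‖Cᴴ * C‖ * ‖Y‖ := norm_trace_mul_le _ _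
    _ ≤ (Cᴴ * C).trace.re * √(Yᴴ * Y).trace.re := by
        rw [← frobenius_norm_sq_eq_trace Y, Real.sqrt_sq (norm_nonneg _)]
        gcongr
        exact norm_conjTranspose_mul_self_le_trace C
    _ = _ := by rw [e2, e3]

/-- With `‖·‖₂` the Hilbert–Schmidt norm, `‖P‖₂ ≤ tr P = ‖P‖₂²` and `‖P‖₂ > 0`. -/
theorem one_le_re_trace_of_isStarProjection {P : Matrix n n ℂ} (hP : IsStarProjection P)
    (hP0 : P ≠ 0) : 1 ≤ P.trace.re := by
  have hPP : Pᴴ * P = P := by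
    rw [show Pᴴ = P from hP.isSelfAdjoint]; exact hP.isIdempotentElem
  have h1 := norm_conjTranspose_mul_self_le_trace P
  have h2 := frobenius_norm_sq_eq_trace P
  rw [hPP] at h1 h2
  have h3 : 0 < ‖P‖ := norm_pos_iff.2 hP0
  nlinarith

theorem re_trace_mul_nonneg {P ρ : Matrix n n ℂ} (hP : IsStarProjection P)
    (hρ : ρ.PosSemidef) : 0 ≤ (P * ρ).trace.re := by
  have h : (Pᴴ * ρ * P).trace = (P * ρ).trace := by
    rw [trace_mul_comm, ← mul_assoc, show Pᴴ = P from hP.isSelfAdjoint,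
      show P * P = P from hP.isIdempotentElem]
  rw [← h]
  exact (Complex.le_def.1 (hρ.conjTranspose_mul_mul_same P).trace_nonneg).1

end Frobenius

/-! ### Choi matrices and their reduced operators -/

section Choi
open Matrix
open scoped ComplexOrder

variable {d : ℕ}

open scoped Kronecker in
theorem reducedOperator_choiMatrix (Λ : QuantumChannel d) :
    reducedOperator (choiMatrix Λ) = (d : ℂ)⁻¹ • Λ.map 1 := by
  unfold reducedOperator
  congr 1
  rw [← sum_single_one, map_sum]
  ext i j
  simp [partialTraceFst, choiMatrix, Matrix.sum_apply, Matrix.single_apply, ite_and]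

open scoped Matrix.Norms.L2Operator MatrixOrder in
theorem QuantumChannel.posSemidef_map_one (Λ : QuantumChannel d) : (Λ.map 1).PosSemidef := by
  have h : (0 : Matrix (Fin d) (Fin d) ℂ) ≤ Λ.toCompletelyPositiveMap 1 := by
    have := OrderHomClass.mono Λ.toCompletelyPositiveMap
      (zero_le_one : (0 : Matrix (Fin d) (Fin d) ℂ) ≤ 1)
    rwa [map_zero] at this
  exact nonneg_iff_posSemidef.1 h

theorem posSemidef_reducedOperator_choiMatrix (Λ : QuantumChannel d) :
    (reducedOperator (choiMatrix Λ)).PosSemidef := by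
  rw [reducedOperator_choiMatrix]
  exact Λ.posSemidef_map_one.smul (by positivity)

/-- `X ↦ φ_X` as a real-linear map. -/
noncomputable def reducedOperatorLinear (d : ℕ) :
    Matrix (Fin d × Fin d) (Fin d × Fin d) ℂ →ₗ[ℝ] Matrix (Fin d) (Fin d) ℂ where
  toFun := reducedOperator
  map_add' X Y := by
    ext i j
    simp [reducedOperator, partialTraceFst, Finset.sum_add_distrib, mul_add]
  map_smul' c X := by
    ext i j
    simp [reducedOperator, partialTraceFst, Finset.mul_sum, mul_left_comm]

/-- Differentiability of matrix-valued maps refers to the bare entrywise topology on matrices; the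
entrywise sup norm, which induces it, makes the normed-space chain rule available. -/
theorem DifferentiableAt.hasDerivAt_matrix_linearMap {m n : Type*} [Fintype m] [Fintype n]
    {E : Type*} [NormedAddCommGroup E] [NormedSpace ℝ E]
    (T : Matrix m n ℂ →ₗ[ℝ] E) {M : ℝ → Matrix m n ℂ} {t : ℝ} (h : DifferentiableAt ℝ M t) :
    HasDerivAt (fun t => T (M t)) (T (deriv M t)) t := by
  open scoped Matrix.Norms.Elementwise in
  exact (LinearMap.toContinuousLinearMap T).hasFDerivAt.comp_hasDerivAt t
    (DifferentiableAt.hasDerivAt h)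

/-- An entrywise derivative of a family of Hermitian matrices is Hermitian. -/
theorem isHermitian_of_hasDerivAt {n : Type*} {M : ℝ → Matrix n n ℂ} {M' : Matrix n n ℂ} {t : ℝ}
    (h : ∀ i j, HasDerivAt (fun t => M t i j) (M' i j) t) (hM : ∀ t, (M t).IsHermitian) :
    M'.IsHermitian := by
  ext i j
  have h1 := (h j i).star
  have : (fun t => star (M t j i)) = fun t => M t i j := funext fun t => (hM t).apply i j
  rw [this] at h1
  exact h1.unique (h i j)

/-! ### The error along a path of channels -/

variable {Λ : QuantumChannel d} {Γ : ℝ → QuantumChannel d} {P : Matrix (Fin d) (Fin d) ℂ}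

theorem resetError_eq (hd : d ≠ 0) :
    resetError P Λ = d * (P * reducedOperator (choiMatrix Λ)).trace.re := by
  have : (d : ℂ) ≠ 0 := by exact_mod_cast hd
  rw [reducedOperator_choiMatrix, resetError, mul_smul_comm, trace_smul, smul_eq_mul]
  rw [← Complex.ofReal_natCast, ← Complex.ofReal_inv, Complex.re_ofReal_mul]
  field_simp

/-- Along a path of finite length, the error drops from that of the identity channel by at most the
factor `exp (-length)`. -/
theorem IsChannelPath.resetError_identity_le (hΓ : IsChannelPath Λ Γ) (hP : IsStarProjection P)
    (hL : pathLength Γ ≠ ∞) :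
    resetError P (QuantumChannel.identity d) ≤
      Real.exp (pathLength Γ).toReal * resetError P Λ := by
  rcases Nat.eq_zero_or_pos d with rfl | hd
  · simp [resetError, trace]
  obtain ⟨s, hs, hdiff⟩ := hΓ.differentiable
  -- `T M = tr (P φ_M)`, as a real-linear functional, so that it commutes with `deriv`.
  set T : Matrix (Fin d × Fin d) (Fin d × Fin d) ℂ →ₗ[ℝ] ℝ :=
    Complex.reLm ∘ₗ (traceLinearMap (Fin d) ℝ ℂ) ∘ₗ (LinearMap.mulLeft ℝ P) ∘ₗ
      reducedOperatorLinear d with hT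
  have hTa : ∀ X, T X = (P * reducedOperator X).trace.re := fun _ => rfl
  have hder : ∀ t ∈ Ioo (0 : ℝ) 1 \ s, HasDerivAt (fun t => T (choiMatrix (Γ t)))
      (T (deriv (fun t => choiMatrix (Γ t)) t)) t := fun t ht =>
    (hdiff t ht).hasDerivAt_matrix_linearMap T
  have := le_exp_lintegral_mul_of_abs_deriv_le (f := fun t => T (choiMatrix (Γ t)))
    (g := fun t => lineElement (choiMatrix (Γ t)) (deriv (fun t => choiMatrix (Γ t)) t)) hs
    ?_ (fun t ht => (hder t ht).differentiableAt) ?_ ?_ hL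
  · simp only [hΓ.source, hΓ.target, hTa] at this
    rw [resetError_eq hd.ne', resetError_eq hd.ne', mul_left_comm]
    exact mul_le_mul_of_nonneg_left this d.cast_nonneg
  · have : Continuous T := T.continuous_of_finiteDimensional
    exact this.comp_continuousOn hΓ.continuousOn
  · exact fun t _ => re_trace_mul_nonneg hP (posSemidef_reducedOperator_choiMatrix _)
  · intro t ht hfin
    rw [(hder t ht).deriv, hTa]
    have hu : IsUnit (reducedOperator (choiMatrix (Γ t))) := by
      by_contra hu
      exact hfin (by simp [lineElement, hu])
    have hH : (reducedOperator (deriv (fun t => choiMatrix (Γ t)) t)).IsHermitian :=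
      isHermitian_of_hasDerivAt (M := fun t => reducedOperator (choiMatrix (Γ t)))
        (fun i j => (hdiff t ht).hasDerivAt_matrix_linearMap
          (entryLinearMap ℝ ℂ i j ∘ₗ reducedOperatorLinear d))
        fun t => (posSemidef_reducedOperator_choiMatrix _).isHermitian
    simp only [lineElement, if_pos hu, choiMetric]
    rw [ENNReal.toReal_ofReal (Real.sqrt_nonneg _)]
    exact abs_re_trace_mul_le hP (posSemidef_reducedOperator_choiMatrix _) hu hH

end Choi

/-! ### The infimum over paths -/

theorem mainTheorem2 (d : ℕ) (Λ : QuantumChannel d) (P : Matrix (Fin d) (Fin d) ℂ)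
    (hP : IsStarProjection P) (hP0 : P ≠ 0) :
    (geometricComplexity Λ ≠ ⊤ →
      1 ≤ Real.exp (geometricComplexity Λ).toReal * resetError P Λ) ∧
    (resetError P Λ = 0 → geometricComplexity Λ = ⊤) := by
  have hpath : ∀ Γ, IsChannelPath Λ Γ → pathLength Γ ≠ ∞ →
      1 ≤ Real.exp (pathLength Γ).toReal * resetError P Λ := fun Γ hΓ hL => by
    refine le_trans ?_ (hΓ.resetError_identity_le hP hL)
    simpa [resetError, QuantumChannel.identity, QuantumChannel.map] using
      one_le_re_trace_of_isStarProjection hP hP0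
  have main : geometricComplexity Λ ≠ ⊤ →
      1 ≤ Real.exp (geometricComplexity Λ).toReal * resetError P Λ := by
    intro hC
    -- If the error were not positive, no path could have finite length.
    have hpos : 0 < resetError P Λ := by
      by_contra hneg
      refine hC (eq_top_iff.2 (le_iInf₂ fun Γ hΓ => ?_))
      by_contra hL
      have := hpath Γ hΓ (by simpa using hL)
      nlinarith [Real.exp_pos (pathLength Γ).toReal]
    have hlb : ENNReal.ofReal (-Real.log (resetError P Λ)) ≤ geometricComplexity Λ := by
      refine le_iInf₂ fun Γ hΓ => ?_
      by_cases hL : pathLength Γ = ∞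
      · simp [hL]
      refine ENNReal.ofReal_le_of_le_toReal ?_
      have := Real.log_nonneg (hpath Γ hΓ hL)
      rw [Real.log_mul (Real.exp_pos _).ne' hpos.ne', Real.log_exp] at this
      linarith
    have := (ENNReal.ofReal_le_iff_le_toReal hC).1 hlb
    calc (1 : ℝ) = Real.exp (-Real.log (resetError P Λ)) * resetError P Λ := by
          rw [Real.exp_neg, Real.exp_log hpos, inv_mul_cancel₀ hpos.ne']
      _ ≤ _ := by gcongr
  refine ⟨main, fun h0 => ?_⟩
  by_contra hC
  have := main hC
  rw [h0, mul_zero] at this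
  linarith
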